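/- Let $(X,|\cdot\,\cdot|)$ be a complete metric space whose metric is intrinsic, i.e. for all $x,y\in X$ the distance $|xy|$ is the infimum of the lengths of the continuous curves joining $x$ to $y$. For $p\in X$ and $x,y\in X\setminus\{p\}$ let the model angle $\tilde\angle(p;x,y)\in[0,\pi]$ be the angle at $\tilde p$ of a triangle $\tilde p\tilde x\tilde y$ in the Euclidean plane with $|\tilde p\tilde x|=|px|$, $|\tilde p\tilde y|=|py|$, $|\tilde x\tilde y|=|xy|$. The space $X$ is called an Alexandrov space with curvature $\ge 0$ if, in addition to being complete with intrinsic metric, it satisfies $$\tilde\angle(p;x,y)+\tilde\angle(p;y,z)+\tilde\angle(p;z,x)\le 2\pi$$ for all $p\in X$ and $x,y,z\in X\setminus\{p\}$. Then $X$ is an Alexandrov space with curvature $\ge 0$ if and only if every quadruple of points $p,x,y,z\in X$ satisfies $$|px|^2+|py|^2+|pz|^2\ \ge\ \tfrac13\left(|xy|^2+|yz|^2+|zx|^2\right).$$ -/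

import Mathlib

/-- The metric of `X` is intrinsic: the distance between any two points is the infimum of the
lengths of the continuous curves joining them. The length of a curve is the supremum of
`∑ dist (γ tᵢ) (γ tᵢ₊₁)` over finite partitions, i.e. its total variation. As `edist` is finite,
the infimum is over a nonempty set and some curve has finite length. -/
def IsIntrinsicMetric (X : Type*) [MetricSpace X] : Prop :=
  ∀ x y : X, edist x y = ⨅ γ : Path x y, eVariationOn γ Set.univ

/-- The model angle at `p` of the triple `p, x, y`: for `x ≠ p ≠ y`, the angle at `p̃` of a triangle
`p̃ x̃ ỹ` in the Euclidean plane with the same side lengths (law of cosines). -/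
noncomputable def modelAngle {X : Type*} [MetricSpace X] (p x y : X) : ℝ :=
  Real.arccos ((dist p x ^ 2 + dist p y ^ 2 - dist x y ^ 2) / (2 * dist p x * dist p y))

/-- Alexandrov spaces with curvature `≥ 0`: complete spaces with intrinsic metric in which, for
every quadruple of points whose model angles at `p` are defined, these add up to at most `2π`. -/
structure IsAlexandrovNonneg (X : Type*) [MetricSpace X] : Prop where
  complete : CompleteSpace X
  intrinsic : IsIntrinsicMetric X
  comparison : ∀ p x y z : X, x ≠ p → y ≠ p → z ≠ p →
    modelAngle p x y + modelAngle p y z + modelAngle p z x ≤ 2 * Real.pi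

/-! Let Q(a,b,c) = a² + b² + c² + 2ab cos α + 2bc cos β + 2ca cos γ, with α, β, γ the model angles
at p. For angles in [0, π], Q ≥ 0 on the nonnegative octant exactly when α + β + γ ≤ 2π. By the law
of cosines the quadruple inequality says Q ≥ 0 at (|px|, |py|, |pz|), which settles one direction.
Conversely, apply the inequality to points at arbitrary fractions of px, py, pz: Q ≥ 0 follows at
all ratios, provided these points are at least as far apart as in the model triangles. This side
comparison comes from a median inequality by bisection. Geodesics need not exist, so intermediate
points are only approximate. -/

theorem IsIntrinsicMetric.exists_between {X : Type*} [MetricSpace X] (hX : IsIntrinsicMetric X)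
    (x y : X) {t ε : ℝ} (ht : t ∈ Set.Icc (0 : ℝ) 1) (hε : 0 < ε) :
    ∃ q : X, dist x q = t * dist x y ∧ dist q y ≤ (1 - t) * dist x y + ε := by
  have hlt : (⨅ γ : Path x y, eVariationOn γ Set.univ) < ENNReal.ofReal (dist x y + ε) := by
    rw [← hX x y, edist_dist]
    exact (ENNReal.ofReal_lt_ofReal_iff (by positivity)).2 (by linarith)
  obtain ⟨γ, hγ⟩ := iInf_lt_iff.1 hlt
  have hcont : Continuous fun s => dist x (γ s) := by fun_prop
  have hmem : t * dist x y ∈ Set.Icc (dist x (γ 0)) (dist x (γ 1)) := by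
    simp only [γ.source, γ.target, dist_self]
    exact ⟨mul_nonneg ht.1 dist_nonneg, mul_le_of_le_one_left dist_nonneg ht.2⟩
  obtain ⟨s, hs⟩ := mem_range_of_exists_le_of_exists_ge hcont ⟨0, hmem.1⟩ ⟨1, hmem.2⟩
  have hvar : edist x (γ s) + edist (γ s) y ≤ eVariationOn γ Set.univ := by
    calc edist x (γ s) + edist (γ s) y
        = edist (γ 0) (γ s) + edist (γ s) (γ 1) := by rw [γ.source, γ.target]
      _ ≤ eVariationOn γ (Set.Iic s) + eVariationOn γ (Set.Ici s) :=
          add_le_add (eVariationOn.edist_le _ s.2.1 Set.self_mem_Iic)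
            (eVariationOn.edist_le _ Set.self_mem_Ici s.2.2)
      _ ≤ eVariationOn γ (Set.Iic s ∪ Set.Ici s) :=
          eVariationOn.add_le_union _ fun a ha b hb => le_trans ha hb
      _ ≤ _ := eVariationOn.mono _ (Set.subset_univ _)
  have hle := hvar.trans hγ.le
  rw [edist_dist, edist_dist, ← ENNReal.ofReal_add dist_nonneg dist_nonneg,
    ENNReal.ofReal_le_ofReal_iff (by positivity)] at hle
  simp only at hs
  exact ⟨γ s, hs, by linarith⟩

/-! ### Median inequality and side comparison -/

section Comparison

variable {X : Type*} [MetricSpace X]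

/-- The squared distances from any point to the vertices of a triangle add up to at least a third
of the sum of the squared side lengths. -/
def BarycentricInequality (X : Type*) [MetricSpace X] : Prop :=
  ∀ p x y z : X, dist p x ^ 2 + dist p y ^ 2 + dist p z ^ 2 ≥
    (1 / 3) * (dist x y ^ 2 + dist y z ^ 2 + dist z x ^ 2)

theorem le_of_forall_mul_pos_le {a b K : ℝ} (h : ∀ ε, 0 < ε → ε ≤ 1 → a ≤ b + K * ε) : a ≤ b := by
  refine le_of_forall_pos_le_add fun δ hδ => ?_
  have hK : 0 < |K| + 1 := by positivity
  have := h (min 1 (δ / (|K| + 1))) (by positivity) (min_le_left _ _)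
  refine this.trans (by
    gcongr
    calc K * min 1 (δ / (|K| + 1)) ≤ (|K| + 1) * (δ / (|K| + 1)) := by
          gcongr
          · linarith [le_abs_self K]
          · exact min_le_right _ _
      _ = δ := by field_simp)

theorem sq_le_of_le_add {u s ε : ℝ} (hu : 0 ≤ u) (h : u ≤ s + ε)
    (h0 : 0 ≤ ε) (h1 : ε ≤ 1) :
    u ^ 2 ≤ s ^ 2 + (2 * s + 1) * ε := by
  nlinarith [mul_self_le_mul_self hu h, mul_le_mul_of_nonneg_left h1 h0]

/-- Self-improvement: the inequality at a point one third of the way from z to v divides the excess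
of the coefficient over the Euclidean 2 by three. The price is a growing factor on the failure of z
to be a midpoint of xy. -/
theorem BarycentricInequality.median (h : BarycentricInequality X) (hX : IsIntrinsicMetric X)
    (n : ℕ) (x y z v : X) :
    dist v x ^ 2 + dist v y ^ 2 ≤ (2 + (1 / 3) ^ n) * dist v z ^ 2 + dist x y ^ 2 / 2 +
      3 ^ (n + 1) * (dist z x ^ 2 + dist z y ^ 2 - dist x y ^ 2 / 2) := by
  induction n generalizing v with
  | zero =>
    have := h z v x y
    rw [dist_comm z v, dist_comm y v] at this
    norm_num
    linarith
  | succ n ih =>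
    set D := dist z x ^ 2 + dist z y ^ 2 - dist x y ^ 2 / 2
    refine le_of_forall_mul_pos_le (K := 3 * (4 / 3 * dist v z + 1)) fun ε hε hε1 => ?_
    obtain ⟨q, hq, hq'⟩ := hX.exists_between z v (t := 1 / 3) ⟨by norm_num, by norm_num⟩ hε
    have h1 := h q x y v
    have h2 := ih q
    have h3 := sq_le_of_le_add dist_nonneg hq' hε.le hε1
    rw [dist_comm q z, hq] at h2
    rw [dist_comm y v] at h1
    rw [dist_comm z v] at h2 h3
    rw [pow_succ (3 : ℝ) (n + 1), pow_succ (1 / 3 : ℝ) n]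
    linarith

theorem BarycentricInequality.exists_approx_median (h : BarycentricInequality X)
    (hX : IsIntrinsicMetric X) (R : ℝ) {ε : ℝ} (hε : 0 < ε) :
    ∃ δ > 0, ∀ x y z v : X, dist v z ≤ R → dist z x ^ 2 + dist z y ^ 2 ≤ dist x y ^ 2 / 2 + δ →
      dist v x ^ 2 + dist v y ^ 2 ≤ 2 * dist v z ^ 2 + dist x y ^ 2 / 2 + ε := by
  have hpos : 0 < ε / 2 / (R ^ 2 + 1) := by positivity
  -- n is fixed before δ, which has to absorb the factor `3 ^ (n + 1)`.
  obtain ⟨n, hn⟩ := exists_pow_lt_of_lt_one hpos (by norm_num : (1 / 3 : ℝ) < 1)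
  rw [lt_div_iff₀ (by positivity)] at hn
  refine ⟨ε / 2 / 3 ^ (n + 1), by positivity, fun x y z v hv hz => ?_⟩
  have h1 := h.median hX n x y z v
  have h2 : (3 : ℝ) ^ (n + 1) * (dist z x ^ 2 + dist z y ^ 2 - dist x y ^ 2 / 2) ≤ ε / 2 := by
    rw [← le_div_iff₀' (by positivity)]
    linarith
  have h3 : (1 / 3 : ℝ) ^ n * dist v z ^ 2 ≤ (1 / 3 : ℝ) ^ n * (R ^ 2 + 1) := by
    gcongr
    nlinarith [pow_le_pow_left₀ dist_nonneg hv 2]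
  linarith

/-- Approximate point-on-side comparison with parameter `t`: every pair `p`, `x` admits almost
`t`-intermediate points whose distance to every other point is, up to a small error, at least the
corresponding distance in the Euclidean model triangle. The error is uniform on bounded sets. -/
def SideComparison (X : Type*) [MetricSpace X] (t : ℝ) : Prop :=
  ∀ (p x : X) (R ε : ℝ), 0 < ε → ∃ w : X,
    dist p w ≤ t * dist p x + ε ∧ dist w x ≤ (1 - t) * dist p x + ε ∧
      ∀ y, dist p y ≤ R →
        (1 - t) * dist p y ^ 2 + t * dist x y ^ 2 ≤
          dist w y ^ 2 + t * (1 - t) * dist p x ^ 2 + ε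

theorem sideComparison_zero : SideComparison X 0 := fun p x R ε hε =>
  ⟨p, by simp [hε.le], by simp [hε.le], fun y _ => by simp [hε.le]⟩

theorem SideComparison.symm {t : ℝ} (h : SideComparison X t) : SideComparison X (1 - t) := by
  intro p x R ε hε
  obtain ⟨w, h1, h2, h3⟩ := h x p (R + dist p x) ε hε
  rw [dist_comm x p] at h1 h2 h3
  refine ⟨w, by rwa [dist_comm p w], ?_, fun y hy => ?_⟩
  · rw [dist_comm w x]
    linarith
  · have := h3 y (by linarith [dist_triangle x p y, dist_comm x p])
    linarith

theorem SideComparison.half (h : BarycentricInequality X) (hX : IsIntrinsicMetric X) {t : ℝ}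
    (ht : t ∈ Set.Icc (0 : ℝ) 1) (hs : SideComparison X t) : SideComparison X (t / 2) := by
  intro p x R ε hε
  set a := dist p x with ha
  have ha0 : 0 ≤ a := dist_nonneg
  obtain ⟨δ, hδ, hmed⟩ := h.exists_approx_median hX (R + a + 2) hε
  obtain ⟨η, hη, hη1, hηε, hηδ⟩ : ∃ η > 0, η ≤ 1 ∧ (a + 3) * η ≤ ε ∧ (a + 3) * η ≤ δ := by
    refine ⟨min 1 (min (ε / (a + 3)) (δ / (a + 3))), by positivity, min_le_left _ _, ?_, ?_⟩
    · rw [← le_div_iff₀' (by positivity)]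
      exact (min_le_right _ _).trans (min_le_left _ _)
    · rw [← le_div_iff₀' (by positivity)]
      exact (min_le_right _ _).trans (min_le_right _ _)
  obtain ⟨w, hpw, hwx, hw⟩ := hs p x R η hη
  -- z is almost the midpoint of p and the `t`-point w, so the median inequality applies to it.
  obtain ⟨z, hpz, hzw⟩ := hX.exists_between p w (t := 1 / 2) ⟨by norm_num, by norm_num⟩ hη
  have hta : t * a ≤ a := mul_le_of_le_one_left ha0 ht.2
  have haη : 0 ≤ a * η := by positivity
  refine ⟨z, by linarith, by linarith [dist_triangle z w x], fun y hy => ?_⟩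
  have hpw2 := sq_le_of_le_add dist_nonneg hpw hη.le hη1
  have hzw2 := sq_le_of_le_add dist_nonneg hzw hη.le hη1
  have hpwη : dist p w * η ≤ (a + 1) * η := by gcongr; linarith
  have htaη : t * a * η ≤ a * η := by gcongr
  have hm := hmed p w z y (by linarith [dist_triangle y p z, dist_comm p y]) (by
    rw [dist_comm z p, hpz]
    linarith)
  rw [dist_comm y p, dist_comm y w, dist_comm y z] at hm
  have := hw y hy
  linarith

theorem sideComparison_of_approx {t : ℝ} (ht : t ∈ Set.Icc (0 : ℝ) 1)
    (h : ∀ δ > 0, ∃ s ∈ Set.Icc (0 : ℝ) 1, |s - t| ≤ δ ∧ SideComparison X s) :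
    SideComparison X t := by
  intro p x R ε hε
  set a := dist p x with ha
  have ha0 : 0 ≤ a := dist_nonneg
  set B := a + R ^ 2 + (R + a) ^ 2 + a ^ 2 + 1 with hB
  have hB0 : 0 < B := by positivity
  obtain ⟨s, hs, hst, hcmp⟩ := h (ε / 2 / B) (by positivity)
  rw [le_div_iff₀ hB0] at hst
  obtain ⟨w, hpw, hwx, hw⟩ := hcmp p x R (ε / 2) (by positivity)
  have hδ := abs_nonneg (s - t)
  have hle := le_abs_self (s - t)
  have hge := neg_abs_le (s - t)
  set d := |s - t|
  have hda : d * a ≤ ε / 2 := le_trans (by gcongr; rw [hB]; nlinarith) hst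
  refine ⟨w, ?_, ?_, fun y hy => ?_⟩
  · nlinarith
  · nlinarith
  · have h1 := hw y hy
    have hy0 : dist p y ^ 2 ≤ R ^ 2 := pow_le_pow_left₀ dist_nonneg hy 2
    have hxy : dist x y ^ 2 ≤ (R + a) ^ 2 := pow_le_pow_left₀ dist_nonneg
      (by linarith [dist_triangle x p y, dist_comm x p]) 2
    have h2 : (s - t) * dist p y ^ 2 ≤ d * R ^ 2 := by gcongr
    have h3 : -(s - t) * dist x y ^ 2 ≤ d * (R + a) ^ 2 := by gcongr; linarith
    have h4 : (s - t) * (1 - s - t) ≤ d := by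
      refine (le_abs_self _).trans ?_
      rw [abs_mul]
      exact mul_le_of_le_one_right hδ (abs_le.2 ⟨by linarith [hs.2, ht.2], by linarith [hs.1, ht.1]⟩)
    have h5 : (s - t) * (1 - s - t) * a ^ 2 ≤ d * a ^ 2 := by gcongr
    have h6 : 0 ≤ d * a := by positivity
    rw [hB] at hst
    linarith

/-- Halving and t ↦ 1 - t, starting from 0, reach a dense set of parameters. -/
theorem BarycentricInequality.sideComparison (h : BarycentricInequality X)
    (hX : IsIntrinsicMetric X) {t : ℝ} (ht : t ∈ Set.Icc (0 : ℝ) 1) : SideComparison X t := by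
  have key : ∀ n : ℕ, ∀ t ∈ Set.Icc (0 : ℝ) 1,
      ∃ s ∈ Set.Icc (0 : ℝ) 1, |s - t| ≤ (1 / 2) ^ n ∧ SideComparison X s := by
    intro n
    induction n with
    | zero =>
      exact fun t ht => ⟨0, by simp, by simpa [abs_of_nonneg ht.1] using ht.2, sideComparison_zero⟩
    | succ n ih =>
      have lower : ∀ t ∈ Set.Icc (0 : ℝ) (1 / 2),
          ∃ s ∈ Set.Icc (0 : ℝ) 1, |s - t| ≤ (1 / 2) ^ (n + 1) ∧ SideComparison X s := by
        intro t ht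
        obtain ⟨s, hs, hst, hc⟩ := ih (2 * t) ⟨by linarith [ht.1], by linarith [ht.2]⟩
        refine ⟨s / 2, ⟨by linarith [hs.1], by linarith [hs.1, hs.2]⟩, ?_, hc.half h hX hs⟩
        rw [abs_le, pow_succ] at *
        constructor <;> linarith [hst.1, hst.2]
      intro t ht
      rcases le_total t (1 / 2) with hle | hle
      · exact lower t ⟨ht.1, hle⟩
      · obtain ⟨s, hs, hst, hc⟩ := lower (1 - t) ⟨by linarith [ht.2], by linarith⟩
        refine ⟨1 - s, ⟨by linarith [hs.2], by linarith [hs.1]⟩, ?_, hc.symm⟩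
        rwa [show 1 - s - t = -(s - (1 - t)) by ring, abs_neg]
  refine sideComparison_of_approx ht fun δ hδ => ?_
  obtain ⟨n, hn⟩ := exists_pow_lt_of_lt_one hδ (by norm_num : (1 / 2 : ℝ) < 1)
  obtain ⟨s, hs, hst, hc⟩ := key n t ht
  exact ⟨s, hs, hst.trans hn.le, hc⟩

theorem BarycentricInequality.weighted (h : BarycentricInequality X)
    (hX : IsIntrinsicMetric X) {r s t : ℝ} (hr : r ∈ Set.Icc (0 : ℝ) 1)
    (hs : s ∈ Set.Icc (0 : ℝ) 1) (ht : t ∈ Set.Icc (0 : ℝ) 1) (p x y z : X) :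
    0 ≤ r ^ 2 * dist p x ^ 2 + s ^ 2 * dist p y ^ 2 + t ^ 2 * dist p z ^ 2 +
      r * s * (dist p x ^ 2 + dist p y ^ 2 - dist x y ^ 2) +
      s * t * (dist p y ^ 2 + dist p z ^ 2 - dist y z ^ 2) +
      t * r * (dist p z ^ 2 + dist p x ^ 2 - dist z x ^ 2) := by
  have pair : ∀ {s t ε R : ℝ} {x y x' y' : X}, s ∈ Set.Icc (0 : ℝ) 1 → t ∈ Set.Icc (0 : ℝ) 1 →
      0 ≤ ε → dist p y' ≤ R → dist p x ≤ R →
      (∀ v, dist p v ≤ R → (1 - s) * dist p v ^ 2 + s * dist x v ^ 2 ≤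
        dist x' v ^ 2 + s * (1 - s) * dist p x ^ 2 + ε) →
      (∀ v, dist p v ≤ R → (1 - t) * dist p v ^ 2 + t * dist y v ^ 2 ≤
        dist y' v ^ 2 + t * (1 - t) * dist p y ^ 2 + ε) →
      s ^ 2 * dist p x ^ 2 + t ^ 2 * dist p y ^ 2 -
        s * t * (dist p x ^ 2 + dist p y ^ 2 - dist x y ^ 2) ≤ dist x' y' ^ 2 + 2 * ε := by
    intro s t ε R x y x' y' hs ht hε hy' hx h1 h2
    -- Compare y' with side px, then x and p with side py.
    have e1 := h1 y' hy'
    have e2 := h2 x hx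
    have e3 := h2 p (by simpa using dist_nonneg.trans hx)
    rw [dist_self, dist_comm y p, dist_comm y' p] at e3
    rw [dist_comm y x, dist_comm y' x] at e2
    have e4 := mul_le_mul_of_nonneg_left e2 hs.1
    have e5 := mul_le_mul_of_nonneg_left e3 (sub_nonneg.2 hs.2)
    linarith
  set a := dist p x with ha
  set b := dist p y with hb
  set c := dist p z with hc
  have ha0 : 0 ≤ a := dist_nonneg
  have hb0 : 0 ≤ b := dist_nonneg
  have hc0 : 0 ≤ c := dist_nonneg
  refine le_of_forall_mul_pos_le (K := 3 * ((2 * a + 1) + (2 * b + 1) + (2 * c + 1)) + 6)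
    fun ε hε hε1 => ?_
  have hra := mul_le_of_le_one_left ha0 hr.2
  have hsb := mul_le_of_le_one_left hb0 hs.2
  have htc := mul_le_of_le_one_left hc0 ht.2
  obtain ⟨x', hx', -, hx⟩ := h.sideComparison hX hr p x (a + b + c + 1) ε hε
  obtain ⟨y', hy', -, hy⟩ := h.sideComparison hX hs p y (a + b + c + 1) ε hε
  obtain ⟨z', hz', -, hz⟩ := h.sideComparison hX ht p z (a + b + c + 1) ε hε
  have hxy := pair hr hs hε.le (by linarith) (by linarith) hx hy
  have hyz := pair hs ht hε.le (by linarith) (by linarith) hy hz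
  have hzx := pair ht hr hε.le (by linarith) (by linarith) hz hx
  have hx2 := sq_le_of_le_add dist_nonneg hx' hε.le hε1
  have hy2 := sq_le_of_le_add dist_nonneg hy' hε.le hε1
  have hz2 := sq_le_of_le_add dist_nonneg hz' hε.le hε1
  have hraε : r * a * ε ≤ a * ε := by gcongr
  have hsbε : s * b * ε ≤ b * ε := by gcongr
  have htcε : t * c * ε ≤ c * ε := by gcongr
  have := h p x' y' z'
  linarith

end Comparison

/-! ### Angle sums and the quadratic form -/

section Angles

open Real

theorem quadratic_form_nonneg_of_angle_sum_le {α β γ : ℝ} (hα : α ∈ Set.Icc 0 π)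
    (hβ : β ∈ Set.Icc 0 π) (hγ : γ ∈ Set.Icc 0 π) (h : α + β + γ ≤ 2 * π) {a b c : ℝ}
    (ha : 0 ≤ a) (hb : 0 ≤ b) (hc : 0 ≤ c) :
    0 ≤ a ^ 2 + b ^ 2 + c ^ 2 + 2 * a * b * cos α + 2 * b * c * cos β + 2 * c * a * cos γ := by
  rcases le_total π (α + β) with hle | hle
  · have h1 : cos (α + β) ≤ cos γ := by
      rw [← cos_two_pi_sub]
      exact cos_le_cos_of_nonneg_of_le_pi hγ.1 (by linarith) (by linarith)
    have h2 := mul_le_mul_of_nonneg_left h1 (mul_nonneg hc ha)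
    rw [cos_add] at h2
    have hsα : sin α ^ 2 = 1 - cos α ^ 2 := sin_sq α
    have hsβ : sin β ^ 2 = 1 - cos β ^ 2 := sin_sq β
    -- Squared length of a sum of plane vectors of lengths a, b, c in directions α, 0, -β.
    have h3 : 0 ≤ (a * cos α + b + c * cos β) ^ 2 + (a * sin α - c * sin β) ^ 2 := by positivity
    have h4 : (a * cos α + b + c * cos β) ^ 2 + (a * sin α - c * sin β) ^ 2 =
        a ^ 2 + b ^ 2 + c ^ 2 + 2 * a * b * cos α + 2 * b * c * cos β +
          2 * (c * a * (cos α * cos β - sin α * sin β)) := by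
      linear_combination a ^ 2 * hsα + c ^ 2 * hsβ
    linarith
  · have h1 : -cos β ≤ cos α := by
      rw [← cos_pi_sub]
      exact cos_le_cos_of_nonneg_of_le_pi hα.1 (by linarith [hβ.1]) (by linarith)
    have h2 := mul_le_mul_of_nonneg_left h1 (mul_nonneg ha hb)
    have h3 := mul_le_mul_of_nonneg_left (neg_one_le_cos γ) (mul_nonneg hc ha)
    nlinarith [sq_nonneg (a - c - b * cos β), mul_nonneg (sq_nonneg b) (sq_nonneg (sin β)),
      sin_sq β]

theorem cos_add_cos_neg {α β : ℝ} (hα : α ∈ Set.Icc 0 π) (hβ : β ∈ Set.Icc 0 π)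
    (h : π < α + β) : cos α + cos β < 0 := by
  have : cos α < cos (π - β) :=
    cos_lt_cos_of_nonneg_of_le_pi (by linarith [hβ.2]) hα.2 (by linarith)
  rw [cos_pi_sub] at this
  linarith

theorem angle_sum_le_of_quadratic_form_nonneg {α β γ : ℝ} (hα : α ∈ Set.Icc 0 π)
    (hβ : β ∈ Set.Icc 0 π) (hγ : γ ∈ Set.Icc 0 π)
    (h : ∀ a b c : ℝ, 0 ≤ a → 0 ≤ b → 0 ≤ c →
      0 ≤ a ^ 2 + b ^ 2 + c ^ 2 + 2 * a * b * cos α + 2 * b * c * cos β + 2 * c * a * cos γ) :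
    α + β + γ ≤ 2 * π := by
  by_contra! hlt
  rcases eq_or_lt_of_le hα.2 with rfl | hα'
  · have hneg := cos_add_cos_neg hβ hγ (by linarith)
    -- The value is c² + 2c(cos β + cos γ), minimal at this c.
    have := h 1 1 (-(cos β + cos γ)) zero_le_one zero_le_one (by linarith)
    rw [cos_pi] at this
    nlinarith
  rcases eq_or_lt_of_le hβ.2 with rfl | hβ'
  · have hneg := cos_add_cos_neg hα hγ (by linarith)
    have := h (-(cos α + cos γ)) 1 1 (by linarith) zero_le_one zero_le_one
    rw [cos_pi] at this
    nlinarith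
  have hsα : 0 < sin α := sin_pos_of_pos_of_lt_pi (by linarith [hγ.2]) hα'
  have hsβ : 0 < sin β := sin_pos_of_pos_of_lt_pi (by linarith [hγ.2]) hβ'
  have hs : 0 ≤ -sin (α + β) := by
    have := sin_nonneg_of_nonneg_of_le_pi (x := α + β - π) (by linarith [hγ.2])
      (by linarith)
    rwa [sin_sub_pi] at this
  have hcos : cos γ < cos (α + β) := by
    rw [← cos_two_pi_sub (α + β)]
    exact cos_lt_cos_of_nonneg_of_le_pi (by linarith) hγ.2 (by linarith)
  -- By the law of sines, these weights balance plane unit vectors at angles α, β, 2π - α - β.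
  have h1 := h (sin β) (-sin (α + β)) (sin α) hsβ.le hs hsα.le
  have h2 := mul_lt_mul_of_pos_left hcos (mul_pos hsα hsβ)
  rw [cos_add] at h2
  rw [sin_add] at h1
  have h3 : sin β ^ 2 + (-(sin α * cos β + cos α * sin β)) ^ 2 + sin α ^ 2 +
      2 * sin β * (-(sin α * cos β + cos α * sin β)) * cos α +
      2 * (-(sin α * cos β + cos α * sin β)) * sin α * cos β +
      2 * (sin α * sin β * (cos α * cos β - sin α * sin β)) = 0 := by
    linear_combination -(sin β ^ 2) * sin_sq α - (sin α ^ 2) * sin_sq β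
  linarith

end Angles

/-! ### Model angles and the equivalence -/

section ModelAngle

variable {X : Type*} [MetricSpace X]

theorem modelAngle_mem_Icc (p x y : X) : modelAngle p x y ∈ Set.Icc 0 Real.pi :=
  ⟨Real.arccos_nonneg _, Real.arccos_le_pi _⟩

theorem two_mul_cos_modelAngle {p x y : X} (hx : x ≠ p) (hy : y ≠ p) :
    2 * dist p x * dist p y * Real.cos (modelAngle p x y) =
      dist p x ^ 2 + dist p y ^ 2 - dist x y ^ 2 := by
  have ha : 0 < dist p x := dist_pos.2 hx.symm
  have hb : 0 < dist p y := dist_pos.2 hy.symm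
  have h1 := dist_triangle x p y
  have h2 := dist_triangle p x y
  have h3 := dist_triangle p y x
  rw [dist_comm x p] at h1
  rw [dist_comm y x] at h3
  have h0 : 0 ≤ dist x y := dist_nonneg
  rw [modelAngle, Real.cos_arccos]
  · field_simp
  · rw [le_div_iff₀ (by positivity)]
    nlinarith
  · rw [div_le_one (by positivity)]
    nlinarith

theorem IsAlexandrovNonneg.barycentricInequality (h : IsAlexandrovNonneg X) :
    BarycentricInequality X := by
  -- Covers quadruples with a vertex at p, where the angle condition says nothing.
  have degenerate : ∀ p y z : X, dist y z ^ 2 ≤ 2 * dist p y ^ 2 + 2 * dist p z ^ 2 := by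
    intro p y z
    have h1 := dist_triangle y p z
    rw [dist_comm y p] at h1
    nlinarith [pow_le_pow_left₀ dist_nonneg h1 2, sq_nonneg (dist p y - dist p z)]
  intro p x y z
  rcases eq_or_ne x p with rfl | hx
  · have := degenerate x y z
    rw [dist_self, dist_comm z x]
    nlinarith [sq_nonneg (dist x y), sq_nonneg (dist x z)]
  rcases eq_or_ne y p with rfl | hy
  · have := degenerate y z x
    rw [dist_self, dist_comm x y]
    nlinarith [sq_nonneg (dist y x), sq_nonneg (dist y z)]
  rcases eq_or_ne z p with rfl | hz
  · have := degenerate z x y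
    rw [dist_self, dist_comm y z]
    nlinarith [sq_nonneg (dist z x), sq_nonneg (dist z y)]
  have := quadratic_form_nonneg_of_angle_sum_le (modelAngle_mem_Icc p x y)
    (modelAngle_mem_Icc p y z) (modelAngle_mem_Icc p z x) (h.comparison p x y z hx hy hz)
    (dist_nonneg (x := p) (y := x)) (dist_nonneg (x := p) (y := y))
    (dist_nonneg (x := p) (y := z))
  rw [two_mul_cos_modelAngle hx hy, two_mul_cos_modelAngle hy hz,
    two_mul_cos_modelAngle hz hx] at this
  linarith

theorem BarycentricInequality.modelAngle_sum_le (h : BarycentricInequality X)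
    (hX : IsIntrinsicMetric X) {p x y z : X} (hx : x ≠ p) (hy : y ≠ p) (hz : z ≠ p) :
    modelAngle p x y + modelAngle p y z + modelAngle p z x ≤ 2 * Real.pi := by
  refine angle_sum_le_of_quadratic_form_nonneg (modelAngle_mem_Icc p x y)
    (modelAngle_mem_Icc p y z) (modelAngle_mem_Icc p z x) fun a b c ha hb hc => ?_
  have hpx : 0 < dist p x := dist_pos.2 hx.symm
  have hpy : 0 < dist p y := dist_pos.2 hy.symm
  have hpz : 0 < dist p z := dist_pos.2 hz.symm
  set r := a / dist p x with hr
  set s := b / dist p y with hs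
  set t := c / dist p z with ht
  have hr0 : 0 ≤ r := by positivity
  have hs0 : 0 ≤ s := by positivity
  have ht0 : 0 ≤ t := by positivity
  -- Homogeneity: dividing by N brings the weights into [0, 1].
  set N := r + s + t + 1 with hN
  have hN0 : 0 < N := by positivity
  have mem : ∀ u, 0 ≤ u → u ≤ N → u / N ∈ Set.Icc (0 : ℝ) 1 := fun u h0 h1 =>
    ⟨by positivity, (div_le_one hN0).2 h1⟩
  have key := h.weighted hX (mem r hr0 (by linarith)) (mem s hs0 (by linarith))
    (mem t ht0 (by linarith)) p x y z
  rw [← two_mul_cos_modelAngle hx hy, ← two_mul_cos_modelAngle hy hz,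
    ← two_mul_cos_modelAngle hz hx] at key
  have ea : a = r * dist p x := by rw [hr]; field_simp
  have eb : b = s * dist p y := by rw [hs]; field_simp
  have ec : c = t * dist p z := by rw [ht]; field_simp
  have := mul_nonneg (sq_nonneg N) key
  rw [ea, eb, ec]
  refine this.trans_eq ?_
  clear_value N r s t
  field_simp

end ModelAngle

theorem mainTheorem1 {X : Type*} [MetricSpace X] [CompleteSpace X] (hX : IsIntrinsicMetric X) :
    IsAlexandrovNonneg X ↔
      ∀ p x y z : X,
        dist p x ^ 2 + dist p y ^ 2 + dist p z ^ 2 ≥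
          (1 / 3) * (dist x y ^ 2 + dist y z ^ 2 + dist z x ^ 2) :=
  ⟨fun h => h.barycentricInequality, fun h => ⟨inferInstance, hX, fun _ _ _ _ hx hy hz =>
    BarycentricInequality.modelAngle_sum_le h hX hx hy hz⟩⟩
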